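/- Let $X$ and $Y$ be connected, locally path-connected, semilocally simply connected topological spaces (not necessarily Hausdorff), let $f\colon X\to Y$ be a continuous map, let $x_0\in X$ and $y_0=f(x_0)$, and let $f_\sharp\colon\pi_1(X,x_0)\to\pi_1(Y,y_0)$ be the induced homomorphism. For a space $Z$, let $\mathrm{Cov}(Z)$ be the category whose objects are the coverings $p\colon E\to Z$ (with $E$ possibly disconnected or empty) and whose morphisms are the continuous maps over $Z$. Call a covering of $Z$ trivial if it is isomorphic in $\mathrm{Cov}(Z)$ to a disjoint union $c\cdot Z$ of copies of $Z$, for some cardinal number $c$ (possibly $c=0$). Let $f^{*}\colon\mathrm{Cov}(Y)\to\mathrm{Cov}(X)$ be the pullback functor, which sends $p\colon E\to Y$ to the first projection of $f^{*}(E)=\{(x,e)\in X\times E : f(x)=p(e)\}$, with the subspace topology, onto $X$, and sends a morphism $t$ to the restriction of $\mathrm{id}_X\times t$. Say that $f^{*}$ has nullity zero if every covering $E$ of $Y$ for which $f^{*}(E)$ is trivial is itself trivial. Then $f^{*}$ has nullity zero if and only if $H=\operatorname{im}(f_\sharp)$ is contranormal in $\pi_1(Y,y_0)$, that is, the normal closure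 of $H$ in $\pi_1(Y,y_0)$ is all of $\pi_1(Y,y_0)$. -/

import Mathlib

open CategoryTheory Topology

universe u

/-- Every point has a neighbourhood `U` such that all loops in `U` based at that point are
null-homotopic in the whole space. -/
class SemilocallySimplyConnectedSpace (Y : Type u) [TopologicalSpace Y] : Prop where
  exists_nhds : ∀ y : Y, ∃ U ∈ 𝓝 y, ∀ γ : Path y y, (∀ t, γ t ∈ U) → γ.Homotopic (Path.refl y)

/-- A subgroup is contranormal if its normal closure is the whole group. -/
def Subgroup.IsContranormal {G : Type u} [Group G] (L : Subgroup G) : Prop :=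
  Subgroup.normalClosure (L : Set G) = ⊤

/-- An (unbased) covering of `Y`; the total space may be disconnected or empty. -/
structure Cov (Y : Type u) [TopologicalSpace Y] where
  /-- the total space -/
  total : Type u
  /-- the topology of the total space -/
  [top : TopologicalSpace total]
  /-- the covering projection -/
  proj : total → Y
  /-- the projection is a covering map -/
  isCoveringMap : IsCoveringMap proj

namespace Cov

attribute [instance] Cov.top

/-- Morphisms of coverings: continuous maps over the base. -/
@[ext]
structure Hom {Y : Type u} [TopologicalSpace Y] (E₁ E₂ : Cov Y) where
  /-- the underlying continuous map -/
  map : C(E₁.total, E₂.total)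
  /-- compatibility with the projections -/
  comm : ∀ e, E₂.proj (map e) = E₁.proj e

/-- The category of coverings of `Y`. -/
instance category (Y : Type u) [TopologicalSpace Y] : Category (Cov Y) where
  Hom E₁ E₂ := Hom E₁ E₂
  id E := ⟨ContinuousMap.id _, fun _ => rfl⟩
  comp s t := ⟨t.map.comp s.map, fun e => (t.comm _).trans (s.comm e)⟩

/-- The projection of a disjoint union of copies of `Y` is a covering map. -/
theorem isCoveringMap_copies (S : Type u) (Y : Type u) [TopologicalSpace Y] :
    IsCoveringMap (fun z : (Σ _ : S, Y) => z.2) := by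
  let _ : TopologicalSpace S := ⊥
  have : DiscreteTopology S := ⟨rfl⟩
  have hc : Continuous (fun z : (Σ _ : S, Y) => z.2) := continuous_sigma fun _ => continuous_id
  have hs : Continuous (fun z : (Σ _ : S, Y) => z.1) := continuous_sigma fun _ => continuous_const
  have hi : Continuous (fun z : Y × S => (⟨z.2, z.1⟩ : Σ _ : S, Y)) :=
    continuous_prod_of_discrete_right.mpr fun s => continuous_sigmaMk (σ := fun _ : S => Y) (i := s)
  intro y
  refine IsEvenlyCovered.to_isEvenlyCovered_preimage (I := S)
    ⟨inferInstance, Set.univ, trivial, isOpen_univ, isOpen_univ,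
      { toFun := fun z => (⟨z.1.2, trivial⟩, z.1.1)
        invFun := fun z => ⟨⟨z.2, z.1.1⟩, trivial⟩
        left_inv := fun _ => rfl
        right_inv := fun _ => rfl
        continuous_toFun := ?_
        continuous_invFun := ?_ }, fun _ => rfl⟩
  · exact ((hc.comp continuous_subtype_val).subtype_mk _).prodMk (hs.comp continuous_subtype_val)
  · exact (hi.comp ((continuous_subtype_val.comp continuous_fst).prodMk continuous_snd)).subtype_mk _

/-- The covering `c · Y` of `Y`, the disjoint union of copies of `Y` indexed by a set `S` of
cardinality `c`. -/
def copies (S : Type u) (Y : Type u) [TopologicalSpace Y] : Cov Y where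
  total := Σ _ : S, Y
  proj z := z.2
  isCoveringMap := isCoveringMap_copies S Y

/-- A covering is trivial if it is isomorphic to `c · Y` for some cardinal `c`. -/
def IsTrivial {Y : Type u} [TopologicalSpace Y] (E : Cov Y) : Prop :=
  ∃ S : Type u, Nonempty (E ≅ copies S Y)

variable {X Y : Type u} [TopologicalSpace X] [TopologicalSpace Y]

/-- The pullback of a covering map is a covering map. -/
theorem isCoveringMap_pullback (f : C(X, Y)) (E : Cov Y) :
    IsCoveringMap (fun z : {z : X × E.total // f z.1 = E.proj z.2} => z.1.1) := by
  intro x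
  obtain ⟨hd, U, hxU, hU, -, H, hH⟩ := E.isCoveringMap (f x)
  have hU' : IsOpen (f ⁻¹' U) := hU.preimage f.continuous
  have hH' : ∀ w, E.proj (H.symm w).1 = w.1.1 := fun w => by
    rw [← hH, Homeomorph.apply_symm_apply]
  refine IsEvenlyCovered.to_isEvenlyCovered_preimage (I := E.proj ⁻¹' {f x})
    ⟨hd, f ⁻¹' U, hxU, hU', hU'.preimage (continuous_fst.comp continuous_subtype_val),
      { toFun := fun z => (⟨z.1.1.1, z.2⟩, (H ⟨z.1.1.2, by
          have h := z.2
          simpa only [Set.mem_preimage, z.1.2] using h⟩).2)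
        invFun := fun w => ⟨⟨(w.1.1, (H.symm (⟨f w.1.1, w.1.2⟩, w.2)).1), (hH' (⟨f w.1.1, w.1.2⟩, w.2)).symm⟩, w.1.2⟩
        left_inv := ?_
        right_inv := ?_
        continuous_toFun := by fun_prop
        continuous_invFun := ?_ }, fun _ => rfl⟩
  · rintro ⟨⟨⟨a, e⟩, (h : f a = E.proj e)⟩, (ha : f a ∈ U)⟩
    have he : e ∈ E.proj ⁻¹' U := by
      change E.proj e ∈ U
      rwa [← h]
    have hw : ((⟨f a, ha⟩ : U), (H ⟨e, he⟩).2) = H ⟨e, he⟩ :=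
      Prod.ext (Subtype.ext (h.trans (hH ⟨e, he⟩).symm)) rfl
    refine Subtype.ext (Subtype.ext (Prod.ext rfl ?_))
    change (H.symm (⟨f a, ha⟩, (H ⟨e, he⟩).2)).1 = e
    rw [hw, Homeomorph.symm_apply_apply]
  · rintro ⟨⟨a, ha⟩, s⟩
    exact Prod.ext rfl (by simp)
  · have h₁ : Continuous fun w : (f ⁻¹' U) × (E.proj ⁻¹' {f x}) =>
        ((⟨f w.1.1, w.1.2⟩ : U), w.2) := by fun_prop
    exact ((by fun_prop : Continuous fun w : (f ⁻¹' U) × (E.proj ⁻¹' {f x}) => w.1.1).prodMk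
      (continuous_subtype_val.comp (H.symm.continuous.comp h₁))).subtype_mk _ |>.subtype_mk _

/-- The topological pullback functor `f* : Cov(Y) ⥤ Cov(X)`: on objects the subspace
`{(x, e) | f x = p e}` of `X × E` with the first projection, on morphisms the restriction
of `id × t`. -/
def pullback (f : C(X, Y)) : Cov Y ⥤ Cov X where
  obj E :=
    { total := {z : X × E.total // f z.1 = E.proj z.2}
      proj := fun z => z.1.1
      isCoveringMap := isCoveringMap_pullback f E }
  map {E₁ E₂} t :=
    { map :=
        { toFun := fun z => ⟨(z.1.1, t.map z.1.2), z.2.trans (t.comm _).symm⟩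
          continuous_toFun := by fun_prop }
      comm := fun _ => rfl }

/-- A functor between categories of coverings has nullity zero if it sends only trivial coverings
to trivial coverings. -/
def NullityZero (F : Cov Y ⥤ Cov X) : Prop :=
  ∀ E : Cov Y, (F.obj E).IsTrivial → E.IsTrivial

end Cov

/-!
Over a connected, locally path-connected base, a covering is trivial if and only if the fundamental
group acts trivially on a fibre: a point of the fibre that is fixed by all loops extends to a global
section. The action of `π₁(X, x₀)` on the fibre of `f^* E` is the restriction along `f_♯` of the
action of `π₁(Y, f x₀)` on the fibre of `E`, so `f^* E` is trivial if and only if the kernel of the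
latter action contains `im f_♯`. These kernels are exactly the normal subgroups of `π₁(Y, f x₀)`:
given `N`, extend the action on the cosets of `N` to a functor on the fundamental groupoid, and
topologize the disjoint union of its values. Hence `f^*` has nullity zero if and only if the only
normal subgroup containing `im f_♯` is the whole group.
-/

universe v w

section Covering

variable {E E' X X' : Type*} [TopologicalSpace E] [TopologicalSpace E'] [TopologicalSpace X]
  [TopologicalSpace X'] {p : E → X} {p' : E' → X'}

theorem monodromy_map_of_comm (hp : IsCoveringMap p) (hp' : IsCoveringMap p') (f : C(X, X'))
    (g : C(E, E')) (h : ∀ e, p' (g e) = f (p e)) {x y : X} (γ : Path.Homotopic.Quotient x y)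
    (e : p ⁻¹' {x}) :
    hp'.monodromy (γ.map f) ⟨g e, (h e).trans (congrArg f e.2)⟩ =
      ⟨g (hp.monodromy γ e), (h _).trans (congrArg f (hp.monodromy γ e).2)⟩ := by
  induction γ using Path.Homotopic.Quotient.ind with | mk γ =>
  have h_lift := hp.liftPath_lifts γ e (γ.source.trans e.2.symm)
  have h_comp : g.comp (hp.liftPath γ e (γ.source.trans e.2.symm)) =
      hp'.liftPath (γ.map f.continuous) (g e)
        ((γ.map f.continuous).source.trans ((h e).trans (congrArg f e.2)).symm) :=
    (hp'.eq_liftPath_iff' _).2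
      ⟨funext fun t => (h _).trans (congrArg f (congrFun h_lift t)),
        congrArg g (hp.liftPath_zero ..)⟩
  exact Subtype.ext (DFunLike.congr_fun h_comp 1).symm

theorem monodromy_section (hp : IsCoveringMap p) (s : C(X, E)) (hs : ∀ x, p (s x) = x) {x y : X}
    (γ : Path.Homotopic.Quotient x y) :
    hp.monodromy γ ⟨s x, hs x⟩ = ⟨s y, hs y⟩ := by
  refine hp.monodromy_eq_of_map_eq (γ.map s) ?_
  induction γ using Path.Homotopic.Quotient.ind with | mk γ =>
  exact congrArg Path.Homotopic.Quotient.mk (Path.ext (funext fun t => hs (γ t)))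

theorem mem_range_mapOfEq_of_monodromy_eq_self (hp : IsCoveringMap p) {x : X} {e : p ⁻¹' {x}}
    {γ : FundamentalGroup X x} (h : hp.monodromy γ e = e) :
    γ ∈ (FundamentalGroup.mapOfEq ⟨p, hp.continuous⟩ e.2).range := by
  refine ⟨(hp.liftPathQuotient γ e).cast rfl (congrArg Subtype.val h).symm, ?_⟩
  refine (FundamentalGroup.mapOfEq_apply _ _ _).trans ?_
  rw [Path.Homotopic.Quotient.map_cast, hp.map_liftPathQuotient]
  refine (Path.Homotopic.Quotient.cast_cast _ _ _ _ _).trans ?_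
  refine (Path.Homotopic.Quotient.cast_cast _ _ _ _ _).trans ?_
  exact Path.Homotopic.Quotient.cast_rfl_rfl γ

theorem exists_section_of_monodromy_eq_self [PathConnectedSpace X] [LocallyPathConnectedSpace X]
    (hp : IsCoveringMap p) {x : X} (e : p ⁻¹' {x})
    (h : ∀ γ : FundamentalGroup X x, hp.monodromy γ e = e) :
    ∃ s : C(X, E), s x = e ∧ ∀ y, p (s y) = y := by
  obtain ⟨s, ⟨hs_base, hs⟩, -⟩ := hp.existsUnique_continuousMap_lifts_of_range_le
    (f := ContinuousMap.id X) e.2 fun γ _ => mem_range_mapOfEq_of_monodromy_eq_self hp (h γ)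
  exact ⟨s, hs_base, congrFun hs⟩

end Covering

namespace Cov

section Trivial

variable {Y : Type u} [TopologicalSpace Y] {E₁ E₂ : Cov Y}

theorem isIso_of_bijective (t : E₁ ⟶ E₂) (h : Function.Bijective t.map) : IsIso t := by
  have h_local : IsLocalHomeomorph t.map := by
    refine .of_comp (f := t.map) ?_ E₂.isCoveringMap.isLocalHomeomorph t.map.continuous
    rw [show E₂.proj ∘ t.map = E₁.proj from funext t.comm]
    exact E₁.isCoveringMap.isLocalHomeomorph
  let φ : E₁.total ≃ₜ E₂.total :=
    (Equiv.ofBijective t.map h).toHomeomorphOfContinuousOpen t.map.continuous h_local.isOpenMap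
  refine ⟨⟨⟨φ.symm, φ.symm.continuous⟩, fun e => ?_⟩, ?_, ?_⟩
  · exact (t.comm _).symm.trans (congrArg E₂.proj (φ.apply_symm_apply e))
  · exact Hom.ext (ContinuousMap.ext φ.symm_apply_apply)
  · exact Hom.ext (ContinuousMap.ext φ.apply_symm_apply)

/-- The map induced by a morphism of coverings on the fibres over a point. -/
def Hom.fiberMap (t : Hom E₁ E₂) (y : Y) (e : E₁.proj ⁻¹' {y}) : E₂.proj ⁻¹' {y} :=
  ⟨t.map e, (t.comm e).trans e.2⟩

theorem Hom.monodromy_fiberMap (t : Hom E₁ E₂) {x y : Y} (γ : Path.Homotopic.Quotient x y)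
    (e : E₁.proj ⁻¹' {x}) :
    E₂.isCoveringMap.monodromy γ (t.fiberMap x e) =
      t.fiberMap y (E₁.isCoveringMap.monodromy γ e) := by
  induction γ using Path.Homotopic.Quotient.ind with | mk γ =>
  exact monodromy_map_of_comm E₁.isCoveringMap E₂.isCoveringMap (.id Y) t.map t.comm (.mk γ) e

theorem Hom.bijective_map_of_bijective_fiberMap [PathConnectedSpace Y] (t : Hom E₁ E₂) (y₀ : Y)
    (h : Function.Bijective (t.fiberMap y₀)) : Function.Bijective t.map := by
  have h_fiber (y : Y) : Function.Bijective (t.fiberMap y) := by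
    let γ : Path.Homotopic.Quotient y₀ y := .mk (PathConnectedSpace.somePath y₀ y)
    have h_comm : E₂.isCoveringMap.monodromy γ ∘ t.fiberMap y₀ =
        t.fiberMap y ∘ E₁.isCoveringMap.monodromy γ :=
      funext (t.monodromy_fiberMap γ)
    rw [← (E₁.isCoveringMap.monodromy_bijective γ).of_comp_iff, ← h_comm]
    exact (E₂.isCoveringMap.monodromy_bijective γ).comp h
  constructor
  · intro e e' hee'
    have h_proj : E₁.proj e' = E₁.proj e := by rw [← t.comm, ← hee', t.comm]
    exact congrArg Subtype.val <|
      (h_fiber (E₁.proj e)).injective (a₁ := ⟨e, rfl⟩) (a₂ := ⟨e', h_proj⟩) (Subtype.ext hee')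
  · intro e
    obtain ⟨e', he'⟩ := (h_fiber (E₂.proj e)).surjective ⟨e, rfl⟩
    exact ⟨e', congrArg Subtype.val he'⟩

theorem IsTrivial.exists_section {E : Cov Y} (h : E.IsTrivial) (e : E.total) :
    ∃ s : C(Y, E.total), s (E.proj e) = e ∧ ∀ y, E.proj (s y) = y := by
  obtain ⟨S, ⟨φ⟩⟩ := h
  obtain ⟨⟨c, y⟩, rfl⟩ : ∃ z, φ.inv.map z = e :=
    ⟨φ.hom.map e, DFunLike.congr_fun (congrArg Hom.map φ.hom_inv_id) e⟩
  refine ⟨⟨fun y => φ.inv.map ⟨c, y⟩,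
    φ.inv.map.continuous.comp (continuous_sigmaMk (σ := fun _ : S => Y))⟩, ?_,
    fun y => φ.inv.comm ⟨c, y⟩⟩
  exact congrArg (fun y' : Y => φ.inv.map ⟨c, y'⟩) (φ.inv.comm ⟨c, y⟩)

theorem isTrivial_of_forall_exists_section [PathConnectedSpace Y] {E : Cov Y} (y₀ : Y)
    (h : ∀ e : E.proj ⁻¹' {y₀}, ∃ s : C(Y, E.total), s y₀ = e ∧ ∀ y, E.proj (s y) = y) :
    E.IsTrivial := by
  choose s hs_base hs using h
  let t : copies (E.proj ⁻¹' {y₀}) Y ⟶ E :=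
    { map := ⟨fun z => s z.1 z.2, continuous_sigma fun e => (s e).continuous⟩
      comm := fun z => hs z.1 z.2 }
  have h_fiber : Function.Bijective (Hom.fiberMap t y₀) := by
    constructor
    · rintro ⟨⟨e, y⟩, (hy : y = y₀)⟩ ⟨⟨e', y'⟩, (hy' : y' = y₀)⟩ hee'
      have h_base : s e y = s e' y' := congrArg Subtype.val hee'
      rw [hy, hy', hs_base, hs_base] at h_base
      exact Subtype.ext (Sigma.ext (Subtype.ext h_base) (heq_of_eq (hy.trans hy'.symm)))
    · exact fun e => ⟨⟨⟨e, y₀⟩, rfl⟩, Subtype.ext (hs_base e)⟩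
  have := isIso_of_bijective t (Hom.bijective_map_of_bijective_fiberMap t y₀ h_fiber)
  exact ⟨_, ⟨(asIso t).symm⟩⟩

theorem isTrivial_iff_ker_monodromyPerm_eq_top [ConnectedSpace Y] [LocallyPathConnectedSpace Y]
    (E : Cov Y) (y₀ : Y) :
    E.IsTrivial ↔ (E.isCoveringMap.monodromyPerm y₀).ker = ⊤ := by
  have : PathConnectedSpace Y := .of_locallyPathConnectedSpace
  rw [Subgroup.eq_top_iff']
  constructor
  · intro h γ
    refine Equiv.ext ?_
    rintro ⟨e, rfl⟩
    obtain ⟨s, hs_base, hs⟩ := h.exists_section e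
    have h_fixed := monodromy_section E.isCoveringMap s hs γ
    simp only [hs_base] at h_fixed
    exact h_fixed
  · intro h
    exact isTrivial_of_forall_exists_section y₀ fun e =>
      exists_section_of_monodromy_eq_self E.isCoveringMap e fun γ => DFunLike.congr_fun (h γ) e

end Trivial

section Pullback

variable {X Y : Type u} [TopologicalSpace X] [TopologicalSpace Y] (f : C(X, Y)) (x₀ : X)

theorem ker_monodromyPerm_pullback (E : Cov Y) :
    (((pullback f).obj E).isCoveringMap.monodromyPerm x₀).ker =
      (E.isCoveringMap.monodromyPerm (f x₀)).ker.comap (FundamentalGroup.map f x₀) := by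
  let snd : C(((pullback f).obj E).total, E.total) := ⟨fun z => z.1.2, by fun_prop⟩
  have h_snd (γ : FundamentalGroup X x₀) (z) := monodromy_map_of_comm
    ((pullback f).obj E).isCoveringMap E.isCoveringMap f snd (fun z => z.2.symm) γ z
  ext γ
  constructor
  · intro hγ
    refine Equiv.ext fun e => ?_
    let z : ((pullback f).obj E).proj ⁻¹' {x₀} := ⟨⟨(x₀, e), e.2.symm⟩, rfl⟩
    have hz : ((pullback f).obj E).isCoveringMap.monodromy γ z = z := DFunLike.congr_fun hγ z
    exact (h_snd γ z).trans (Subtype.ext (congrArg (fun z => snd z.1) hz))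
  · intro hγ
    refine Equiv.ext fun z => Subtype.ext (Subtype.ext (Prod.ext ?_ ?_))
    · exact (((pullback f).obj E).isCoveringMap.monodromy γ z).2.trans z.2.symm
    · exact congrArg Subtype.val ((h_snd γ z).symm.trans (DFunLike.congr_fun hγ _))

theorem isTrivial_pullback_iff [ConnectedSpace X] [LocallyPathConnectedSpace X] (E : Cov Y) :
    ((pullback f).obj E).IsTrivial ↔
      (FundamentalGroup.map f x₀).range ≤ (E.isCoveringMap.monodromyPerm (f x₀)).ker := by
  rw [isTrivial_iff_ker_monodromyPerm_eq_top _ x₀, ker_monodromyPerm_pullback, ← top_le_iff,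
    ← Subgroup.map_le_iff_le_comap, MonoidHom.range_eq_map]

end Pullback

end Cov

section PathTransport

variable {Y : Type u} [TopologicalSpace Y] (F : FundamentalGroupoid Y ⥤ Type v)

/-- The bijection by which a path acts between the values of a functor on the fundamental groupoid
at its endpoints. -/
noncomputable def pathTransport {x y : Y} (γ : Path x y) : F.obj ⟨x⟩ ≃ F.obj ⟨y⟩ :=
  (F.mapIso (Groupoid.isoEquivHom _ _ |>.symm (FundamentalGroupoid.fromPath (.mk γ)))).toEquiv

theorem pathTransport_congr {x y : Y} {γ δ : Path x y} (h : γ.Homotopic δ) :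
    pathTransport F γ = pathTransport F δ := by
  unfold pathTransport
  rw [(FundamentalGroupoid.fromPath_eq_iff_homotopic γ δ).2 h]

theorem pathTransport_refl {x : Y} (a : F.obj ⟨x⟩) : pathTransport F (Path.refl x) a = a :=
  Functor.map_id_apply F _ a

theorem pathTransport_trans {x y z : Y} (γ : Path x y) (δ : Path y z) (a : F.obj ⟨x⟩) :
    pathTransport F (γ.trans δ) a = pathTransport F δ (pathTransport F γ a) :=
  Functor.map_comp_apply F (FundamentalGroupoid.fromPath (.mk γ))
    (FundamentalGroupoid.fromPath (.mk δ)) a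

variable {A : Type w} [TopologicalSpace A] (f : C(A, Y))

/-- A continuous map is path independent if it sends any two paths with the same endpoints to
homotopic paths. -/
def PathIndependent : Prop :=
  ∀ ⦃a b : A⦄ (p q : Path a b), (p.map f.continuous).Homotopic (q.map f.continuous)

/-- A family of elements of the values of `F` along a map `f` is flat if it is preserved by
transport along the images of all paths. -/
def IsFlat (s : ∀ a, F.obj ⟨f a⟩) : Prop :=
  ∀ ⦃a b : A⦄ (γ : Path a b), pathTransport F (γ.map f.continuous) (s a) = s b

variable {F f}

theorem PathIndependent.of_simplyConnectedSpace [SimplyConnectedSpace A] : PathIndependent f :=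
  fun _ _ p q => (SimplyConnectedSpace.paths_homotopic p q).map f

theorem PathIndependent.of_loops [PathConnectedSpace A] (a₀ : A)
    (h : ∀ γ : Path a₀ a₀, (γ.map f.continuous).Homotopic (.refl (f a₀))) :
    PathIndependent f := by
  intro a b p q
  let δ := PathConnectedSpace.somePath a₀ a
  have h_loop := (FundamentalGroupoid.fromPath_eq_iff_homotopic _ _).2
    (h ((δ.trans p).trans (δ.trans q).symm))
  rw [Path.map_trans, ← Path.map_symm, Path.map_trans, Path.map_trans] at h_loop
  rw [← FundamentalGroupoid.fromPath_eq_iff_homotopic]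
  let toHom {x y : Y} (γ : Path x y) := FundamentalGroupoid.fromPath (.mk γ)
  let d := toHom (δ.map f.continuous)
  have h_inv : (d ≫ toHom (p.map f.continuous)) ≫
      Groupoid.inv (d ≫ toHom (q.map f.continuous)) = 𝟙 _ := h_loop
  rw [Groupoid.inv_eq_inv, IsIso.comp_inv_eq, Category.id_comp, cancel_epi] at h_inv
  exact h_inv

theorem PathIndependent.isFlat_pathTransport [PathConnectedSpace A] (hf : PathIndependent f)
    (a₀ : A) (c : F.obj ⟨f a₀⟩) :
    IsFlat F f fun a =>
      pathTransport F ((PathConnectedSpace.somePath a₀ a).map f.continuous) c := by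
  intro a b γ
  rw [← pathTransport_trans, ← Path.map_trans, pathTransport_congr F (hf _ _)]

theorem PathIndependent.exists_isFlat [PathConnectedSpace A] (hf : PathIndependent f)
    (a₀ : A) (c : F.obj ⟨f a₀⟩) : ∃ s, IsFlat F f s ∧ s a₀ = c := by
  refine ⟨_, hf.isFlat_pathTransport a₀ c, ?_⟩
  rw [pathTransport_congr F (hf _ (.refl a₀))]
  exact pathTransport_refl F c

theorem exists_isOpen_isPathConnected_pathIndependent [LocallyPathConnectedSpace Y]
    [SemilocallySimplyConnectedSpace Y] (y : Y) :
    ∃ U : Set Y, IsOpen U ∧ y ∈ U ∧ IsPathConnected U ∧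
      PathIndependent (⟨Subtype.val, continuous_subtype_val⟩ : C(U, Y)) := by
  obtain ⟨V, hV, h_loop⟩ := SemilocallySimplyConnectedSpace.exists_nhds y
  have hy : y ∈ interior V := mem_interior_iff_mem_nhds.2 hV
  have h_conn : IsPathConnected (pathComponentIn (interior V) y) :=
    isPathConnected_pathComponentIn hy
  have : PathConnectedSpace (pathComponentIn (interior V) y) :=
    isPathConnected_iff_pathConnectedSpace.1 h_conn
  refine ⟨_, isOpen_interior.pathComponentIn y, mem_pathComponentIn_self hy, h_conn,
    .of_loops ⟨y, mem_pathComponentIn_self hy⟩ fun γ => h_loop _ fun t => ?_⟩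
  exact interior_subset (pathComponentIn_subset (γ t).2)

end PathTransport

/-- The total space of the covering determined by a functor on the fundamental groupoid: the
disjoint union of its values. -/
structure MonodromySpace {Y : Type u} [TopologicalSpace Y] (F : FundamentalGroupoid Y ⥤ Type v) :
    Type (max u v) where
  base : Y
  fiber : F.obj ⟨base⟩

namespace MonodromySpace

variable {Y : Type u} [TopologicalSpace Y] {F : FundamentalGroupoid Y ⥤ Type v}

/-- A set is open if with each point it contains the transports of this point along all
sufficiently small paths. -/
instance : TopologicalSpace (MonodromySpace F) where
  IsOpen W := ∀ y a, (⟨y, a⟩ : MonodromySpace F) ∈ W → ∃ V ∈ 𝓝 y, ∀ z (γ : Path y z),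
    (∀ t, γ t ∈ V) → (⟨z, pathTransport F γ a⟩ : MonodromySpace F) ∈ W
  isOpen_univ _ _ _ := ⟨Set.univ, Filter.univ_mem, fun _ _ _ => trivial⟩
  isOpen_inter W W' hW hW' y a h := by
    obtain ⟨V, hV, hVW⟩ := hW y a h.1
    obtain ⟨V', hV', hVW'⟩ := hW' y a h.2
    exact ⟨V ∩ V', Filter.inter_mem hV hV', fun z γ hγ =>
      ⟨hVW z γ fun t => (hγ t).1, hVW' z γ fun t => (hγ t).2⟩⟩
  isOpen_sUnion S hS y a := by
    rintro ⟨W, hW, h⟩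
    obtain ⟨V, hV, hVW⟩ := hS W hW y a h
    exact ⟨V, hV, fun z γ hγ => ⟨W, hW, hVW z γ hγ⟩⟩

theorem isOpen_iff {W : Set (MonodromySpace F)} :
    IsOpen W ↔ ∀ y a, (⟨y, a⟩ : MonodromySpace F) ∈ W → ∃ V ∈ 𝓝 y, ∀ z (γ : Path y z),
      (∀ t, γ t ∈ V) → (⟨z, pathTransport F γ a⟩ : MonodromySpace F) ∈ W :=
  Iff.rfl

theorem continuous_base : Continuous (base (F := F)) where
  isOpen_preimage U hU := isOpen_iff.2 fun y _ hy =>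
    ⟨U, hU.mem_nhds hy, fun z γ hγ => by simpa only [γ.target] using! hγ 1⟩

theorem continuous_mk_of_isFlat {A : Type w} [TopologicalSpace A] [LocallyPathConnectedSpace A]
    {f : C(A, Y)} {s : ∀ a, F.obj ⟨f a⟩} (hs : IsFlat F f s) :
    Continuous (fun a => (⟨f a, s a⟩ : MonodromySpace F)) where
  isOpen_preimage W hW := by
    refine isOpen_iff_mem_nhds.2 fun a ha => ?_
    obtain ⟨V, hV, hVW⟩ := isOpen_iff.1 hW (f a) (s a) ha
    obtain ⟨P, ⟨hP, hP_conn⟩, hPV⟩ :=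
      (path_connected_basis a).mem_iff.1 (f.continuous.continuousAt hV)
    refine Filter.mem_of_superset hP fun b hb => ?_
    obtain ⟨γ, hγ⟩ := hP_conn.joinedIn a (mem_of_mem_nhds hP) b hb
    have h_mem := hVW (f b) (γ.map f.continuous) fun t => hPV (hγ t)
    rwa [hs] at h_mem

theorem isOpen_range_mk_of_isFlat {U : Set Y} (hU : IsOpen U) {s : ∀ z : U, F.obj ⟨z⟩}
    (hs : IsFlat F ⟨Subtype.val, continuous_subtype_val⟩ s) :
    IsOpen (Set.range fun z : U => (⟨z, s z⟩ : MonodromySpace F)) := by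
  refine isOpen_iff.2 ?_
  rintro _ _ ⟨⟨z, hz⟩, ⟨⟩⟩
  refine ⟨U, hU.mem_nhds hz, fun w γ hγ => ?_⟩
  have hw : w ∈ U := by simpa only [γ.target] using hγ 1
  let γU : Path (⟨z, hz⟩ : U) ⟨w, hw⟩ :=
    ⟨⟨fun t => ⟨γ t, hγ t⟩, by fun_prop⟩, Subtype.ext γ.source, Subtype.ext γ.target⟩
  exact ⟨⟨w, hw⟩, congrArg (mk w) (hs γU).symm⟩

theorem isEvenlyCovered_base [LocallyPathConnectedSpace Y] {U : Set Y} (hU : IsOpen U) {y : Y}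
    (hy : y ∈ U) (T : ∀ z : U, F.obj ⟨y⟩ ≃ F.obj ⟨z⟩)
    (hT : ∀ a, IsFlat F ⟨Subtype.val, continuous_subtype_val⟩ fun z => T z a) :
    IsEvenlyCovered (base (F := F)) y (base (F := F) ⁻¹' {y}) := by
  let _ : TopologicalSpace (F.obj ⟨y⟩) := ⊥
  have : DiscreteTopology (F.obj ⟨y⟩) := ⟨rfl⟩
  have : LocallyPathConnectedSpace U := hU.locallyPathConnectedSpace
  refine IsEvenlyCovered.to_isEvenlyCovered_preimage (I := F.obj ⟨y⟩)
    ⟨inferInstance, U, hy, hU, hU.preimage continuous_base,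
      { toFun := fun e => (⟨e.1.base, e.2⟩, (T ⟨e.1.base, e.2⟩).symm e.1.fiber)
        invFun := fun z => ⟨⟨z.1, T z.1 z.2⟩, z.1.2⟩
        left_inv := fun e => Subtype.ext (congrArg (mk e.1.base) (Equiv.apply_symm_apply _ _))
        right_inv := fun z => Prod.ext rfl ((T z.1).symm_apply_apply z.2)
        continuous_toFun := ?_
        continuous_invFun := ?_ }, fun _ => rfl⟩
  · refine ((continuous_base.comp continuous_subtype_val).subtype_mk _).prodMk
      (continuous_discrete_rng.2 fun a => ?_)
    convert (isOpen_range_mk_of_isFlat hU (hT a)).preimage continuous_subtype_val using 1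
    ext ⟨⟨z, b⟩, hz⟩
    constructor
    · rintro rfl
      exact ⟨⟨z, hz⟩, congrArg (mk z) (Equiv.apply_symm_apply _ _)⟩
    · rintro ⟨_, ⟨⟩⟩
      exact Equiv.symm_apply_apply _ _
  · exact (continuous_prod_of_discrete_right.2 fun a => continuous_mk_of_isFlat (hT a)).subtype_mk _

theorem isCoveringMap_base [LocallyPathConnectedSpace Y] [SemilocallySimplyConnectedSpace Y] :
    IsCoveringMap (base (F := F)) := by
  intro y
  obtain ⟨U, hU, hy, h_conn, h_indep⟩ := exists_isOpen_isPathConnected_pathIndependent y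
  have : PathConnectedSpace U := isPathConnected_iff_pathConnectedSpace.1 h_conn
  exact isEvenlyCovered_base hU hy _ (h_indep.isFlat_pathTransport ⟨y, hy⟩)

theorem monodromy_base (h_cov : IsCoveringMap (base (F := F))) {x y : Y} (γ : Path x y)
    (a : F.obj ⟨x⟩) :
    h_cov.monodromy (.mk γ) ⟨⟨x, a⟩, rfl⟩ = ⟨⟨y, pathTransport F γ a⟩, rfl⟩ := by
  have : ContractibleSpace unitInterval := (convex_Icc (0 : ℝ) 1).contractibleSpace ⟨0, by simp⟩
  have : LocallyPathConnectedSpace unitInterval := (convex_Icc (0 : ℝ) 1).locallyPathConnectedSpace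
  obtain ⟨γ, rfl, rfl⟩ := γ
  obtain ⟨s, hs, rfl⟩ := PathIndependent.of_simplyConnectedSpace.exists_isFlat (0 : unitInterval) a
  let lift : Path (⟨γ 0, s 0⟩ : MonodromySpace F) ⟨γ 1, s 1⟩ :=
    ⟨⟨fun t => ⟨γ t, s t⟩, continuous_mk_of_isFlat hs⟩, rfl, rfl⟩
  have h_end := hs (⟨.id unitInterval, rfl, rfl⟩ : Path (0 : unitInterval) 1)
  refine (h_cov.monodromy_map (.mk lift)).trans ?_
  exact Subtype.ext (congrArg (mk (γ 1)) h_end.symm)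

end MonodromySpace

section ExtendPermRep

variable {C : Type u} [Groupoid.{v} C] {c : C} {S : Type w} (g : ∀ d, c ⟶ d)
  (φ : End c →* Equiv.Perm S)

/-- The extension of a permutation representation of the automorphism group of `c` to a connected
groupoid, along a choice of morphisms `g d` from `c` to every object `d`. -/
def extendPermRep : C ⥤ Type w where
  obj _ := S
  map {d d'} p := ↾(φ (.of (g d ≫ p ≫ Groupoid.inv (g d'))))
  map_id d := by
    have h_one : End.of (g d ≫ 𝟙 d ≫ Groupoid.inv (g d)) = 1 := by
      rw [Category.id_comp, Groupoid.comp_inv, End.one_def]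
    rw [h_one, map_one]
    rfl
  map_comp {d d' d''} p q := by
    -- Without `End.of`, `*` would be the opposite multiplication of `Groupoid.vertexGroup`.
    have h_mul : End.of (g d ≫ (p ≫ q) ≫ Groupoid.inv (g d'')) =
        .of (g d' ≫ q ≫ Groupoid.inv (g d'')) * .of (g d ≫ p ≫ Groupoid.inv (g d')) := by
      simp [End.mul_def, Groupoid.inv_eq_inv]
    rw [h_mul, map_mul]
    rfl

theorem extendPermRep_map_eq_id_iff (γ : End c) :
    (extendPermRep g φ).map γ = 𝟙 _ ↔ γ ∈ φ.ker := by
  have h_conj : End.of (g c ≫ γ ≫ Groupoid.inv (g c)) = (End.of (g c))⁻¹ * γ * End.of (g c) := rfl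
  have h_map : (extendPermRep g φ).map γ = 𝟙 _ ↔
      φ (.of (g c ≫ γ ≫ Groupoid.inv (g c))) = 1 :=
    ⟨fun h => Equiv.ext (ConcreteCategory.congr_hom h), fun h => by
      ext a
      exact DFunLike.congr_fun h a⟩
  rw [h_map, h_conj, map_mul, map_mul, map_inv, mul_assoc, inv_mul_eq_one, right_eq_mul,
    MonoidHom.mem_ker]

end ExtendPermRep

namespace Cov

variable {Y : Type u} [TopologicalSpace Y] [LocallyPathConnectedSpace Y]
  [SemilocallySimplyConnectedSpace Y]

/-- The covering of `Y` determined by a functor on the fundamental groupoid. -/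
def ofFunctor (F : FundamentalGroupoid Y ⥤ Type u) : Cov Y where
  total := MonodromySpace F
  proj := MonodromySpace.base
  isCoveringMap := MonodromySpace.isCoveringMap_base

theorem mem_ker_monodromyPerm_ofFunctor_iff {F : FundamentalGroupoid Y ⥤ Type u} {y : Y}
    {γ : FundamentalGroup Y y} :
    γ ∈ ((ofFunctor F).isCoveringMap.monodromyPerm y).ker ↔ F.map γ = 𝟙 _ := by
  induction γ using Path.Homotopic.Quotient.ind with | mk γ =>
  have h_mono := MonodromySpace.monodromy_base (ofFunctor F).isCoveringMap γ
  constructor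
  · intro h
    ext a
    have h_fixed := (h_mono a).symm.trans (DFunLike.congr_fun h _)
    exact eq_of_heq (MonodromySpace.mk.inj (congrArg Subtype.val h_fixed)).2
  · intro h
    refine Equiv.ext ?_
    rintro ⟨⟨z, a⟩, (rfl : z = y)⟩
    exact (h_mono a).trans
      (Subtype.ext (congrArg (MonodromySpace.mk z) (ConcreteCategory.congr_hom h a)))

theorem exists_ker_monodromyPerm_eq [ConnectedSpace Y] (y₀ : Y)
    (N : Subgroup (FundamentalGroup Y y₀)) [N.Normal] :
    ∃ E : Cov Y, (E.isCoveringMap.monodromyPerm y₀).ker = N := by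
  have : PathConnectedSpace Y := .of_locallyPathConnectedSpace
  let F : FundamentalGroupoid Y ⥤ Type u := extendPermRep
    (fun y => FundamentalGroupoid.fromPath (.mk (PathConnectedSpace.somePath y₀ y.as)))
    (MulAction.toPermHom (FundamentalGroup Y y₀) (FundamentalGroup Y y₀ ⧸ N))
  refine ⟨ofFunctor F, Subgroup.ext fun γ => ?_⟩
  rw [mem_ker_monodromyPerm_ofFunctor_iff, extendPermRep_map_eq_id_iff,
    ← Subgroup.normalCore_eq_ker, N.normalCore_eq_self]

end Cov

theorem mainTheorem2_general {X Y : Type u} [TopologicalSpace X] [TopologicalSpace Y]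
    [ConnectedSpace X] [LocallyPathConnectedSpace X]
    [ConnectedSpace Y] [LocallyPathConnectedSpace Y] [SemilocallySimplyConnectedSpace Y]
    (f : C(X, Y)) (x₀ : X) :
    Cov.NullityZero (Cov.pullback f) ↔ (FundamentalGroup.map f x₀).range.IsContranormal := by
  have h_nullity : Cov.NullityZero (Cov.pullback f) ↔ ∀ E : Cov Y,
      (FundamentalGroup.map f x₀).range ≤ (E.isCoveringMap.monodromyPerm (f x₀)).ker →
        (E.isCoveringMap.monodromyPerm (f x₀)).ker = ⊤ :=
    forall_congr' fun E =>
      imp_congr (Cov.isTrivial_pullback_iff f x₀ E)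
        (E.isTrivial_iff_ker_monodromyPerm_eq_top (f x₀))
  rw [h_nullity]
  constructor
  · intro h
    obtain ⟨E, hE⟩ := Cov.exists_ker_monodromyPerm_eq (f x₀)
      (Subgroup.normalClosure ((FundamentalGroup.map f x₀).range : Set _))
    exact hE.symm.trans (h E (hE.symm ▸ Subgroup.le_normalClosure))
  · intro h E hE
    exact top_le_iff.1 (h.symm.trans_le (Subgroup.normalClosure_le_normal hE))

theorem mainTheorem2 {X Y : Type u} [TopologicalSpace X] [TopologicalSpace Y]
    [ConnectedSpace X] [LocallyPathConnectedSpace X] [SemilocallySimplyConnectedSpace X]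
    [ConnectedSpace Y] [LocallyPathConnectedSpace Y] [SemilocallySimplyConnectedSpace Y]
    (f : C(X, Y)) (x₀ : X) :
    Cov.NullityZero (Cov.pullback f) ↔ (FundamentalGroup.map f x₀).range.IsContranormal :=
  mainTheorem2_general f x₀
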